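/- Let $q$ be a prime power, $n\ge 1$, $K=\mathbb F_{q^n}$, let $\sigma:K\to K$, $a\mapsto a^q$, with fixed field $F=\mathbb F_q$, and let $R=K[t;\sigma]$ be the skew polynomial ring, in which $ta=\sigma(a)t$ for $a\in K$. For $c\in K^\times$ and $\alpha\in K$ put $\Omega_c(\alpha)=\sigma(c)\alpha c^{-1}$. Let $f\in R$ be monic of degree $m\ge 1$ such that the greatest common right divisor $(f,t)_r$ of $f$ and $t$ is $1$. The minimal central left multiple of $f$ is a polynomial $h$ of minimal degree among the nonzero elements of the center of $R$ of the form $gf$ with $g\in R$; suppose that it is $h(t)=\hat h(t^n)$ for a monic irreducible polynomial $\hat h\in F[x]$. Call $f$ an A-polynomial if its eigenring $\mathcal E(f)=\{g\in R: fg\in Rf\}/Rf$ is a (finite-dimensional) central simple algebra over $F$. Then $f$ is an A-polynomial if and only if $m\le n$ and there exist $c_1,\dots,c_m,b\in K^\times$ with $c_m=1$ such that $$f(t)=\prod_{i=1}^m\bigl(t-\Omega_{c_i}(b)\bigr)=(t-\Omega_{c_1}(b))(t-\Omega_{c_2}(b))\cdots(t-\Omega_{c_m}(b)).$$ In particular,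 if $f$ is an A-polynomial and $m\neq 1$, then $f$ is reducible in $R$, i.e. $f=gh$ with $g,h\in R$ of degree smaller than $m$. -/

import Mathlib

namespace SkewPolynomial

noncomputable section

/-- `Fix(σ)`: the elements of the field `K` that are fixed by (all powers of) the twist
`σ = SkewPolynomial.φ` of the skew polynomial ring `K[t;σ]`. -/
abbrev FixedField (K : Type*) [Field K] [MulSemiringAction (Multiplicative ℕ) K] :
    Subfield K :=
  FixedPoints.subfield (Multiplicative ℕ) K

/-- Membership in `FixedField K` means being fixed by `σ`. -/
theorem mem_fixedField_iff {K : Type*} [Field K] [MulSemiringAction (Multiplicative ℕ) K]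
    (a : K) : a ∈ FixedField K ↔ (φ : K →+* K) a = a := by
  constructor
  · intro h
    exact h (Multiplicative.ofAdd 1)
  · intro h
    change ∀ j : Multiplicative ℕ, j • a = a
    intro j
    have := φ_iterate_apply (Multiplicative.toAdd j) a
    rw [Function.iterate_fixed h] at this
    exact this.symm

/-- The degree of a skew polynomial, with `degree 0 = ⊥` (that is, `-∞`). -/
def degree {K : Type*} [Field K] (f : SkewPolynomial K) : WithBot ℕ :=
  f.support.max

section Division

variable {K : Type*} [Field K] [MulSemiringAction (Multiplicative ℕ) K]

/-- `g` right divides `f`: `f = k * g` for some `k`. -/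
def RightDvd (g f : SkewPolynomial K) : Prop :=
  ∃ k : SkewPolynomial K, f = k * g

/-- `d` is a greatest common right divisor of `f` and `g`. -/
def IsGCRD (f g d : SkewPolynomial K) : Prop :=
  RightDvd d f ∧ RightDvd d g ∧
    ∀ e : SkewPolynomial K, RightDvd e f → RightDvd e g → RightDvd e d

/-- `f` is reducible: it is a product of two skew polynomials of smaller degree. -/
def IsReducible (f : SkewPolynomial K) : Prop :=
  ∃ g h : SkewPolynomial K, f = g * h ∧ degree g < degree f ∧ degree h < degree f

/-- `h` is a nonzero central left multiple of `f` of minimal degree. -/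
def IsMinimalCentralLeftMultiple (f h : SkewPolynomial K) : Prop :=
  h ∈ Subring.center (SkewPolynomial K) ∧ h ≠ 0 ∧ RightDvd f h ∧
    ∀ h' ∈ Subring.center (SkewPolynomial K), h' ≠ 0 → RightDvd f h' → degree h ≤ degree h'

/-- The map `Ω_v(α) = σ(v) α v⁻¹` (the derivation being zero). -/
def Omega (v : Kˣ) (α : K) : K :=
  φ (v : K) * α * (v : K)⁻¹

end Division

section Eigenring

variable {K : Type*} [Field K] [MulSemiringAction (Multiplicative ℕ) K]

/-- The left idealiser `{g | f g ∈ R f}` of `f` in `R = K[t;σ]`, as an algebra over the field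
fixed by `σ`. -/
def leftIdealiser (f : SkewPolynomial K) : Subalgebra (FixedField K) (SkewPolynomial K) where
  carrier := {g | RightDvd f (f * g)}
  mul_mem' := by
    rintro a b ⟨k, hk⟩ ⟨l, hl⟩
    exact ⟨k * l, by rw [← mul_assoc, hk, mul_assoc, hl, mul_assoc]⟩
  add_mem' := by
    rintro a b ⟨k, hk⟩ ⟨l, hl⟩
    exact ⟨k + l, by rw [mul_add, hk, hl, add_mul]⟩
  algebraMap_mem' := fun r => ⟨algebraMap _ _ r, (Algebra.commutes r f).symm⟩

/-- The left ideal `R f`, as an ideal of the left idealiser of `f`. -/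
def eigenIdeal (f : SkewPolynomial K) : Ideal (leftIdealiser f) where
  carrier := {g | RightDvd f (g : SkewPolynomial K)}
  add_mem' := by
    rintro a b ⟨k, hk⟩ ⟨l, hl⟩
    exact ⟨k + l, by rw [Subalgebra.coe_add, hk, hl, add_mul]⟩
  zero_mem' := ⟨0, by simp⟩
  smul_mem' := by
    rintro c x ⟨k, hk⟩
    exact ⟨c * k, by rw [smul_eq_mul, Subalgebra.coe_mul, hk, mul_assoc]⟩

instance eigenIdeal_isTwoSided (f : SkewPolynomial K) : (eigenIdeal f).IsTwoSided where
  mul_mem_of_left := by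
    rintro a b ⟨k, hk⟩
    obtain ⟨l, hl⟩ := b.2
    exact ⟨k * l, by rw [Subalgebra.coe_mul, hk, mul_assoc, hl, mul_assoc]⟩

/-- The eigenring of `f`: the quotient of the left idealiser of `f` by `R f`. -/
abbrev Eigenring (f : SkewPolynomial K) : Type _ :=
  leftIdealiser f ⧸ eigenIdeal f

/-- `f` is a (generalised) A-polynomial: its eigenring is a (finite-dimensional) central simple
algebra over the field fixed by `σ`. -/
def IsAPolynomial (f : SkewPolynomial K) : Prop :=
  Algebra.IsCentral (FixedField K) (Eigenring f) ∧ IsSimpleRing (Eigenring f) ∧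
    Module.Finite (FixedField K) (Eigenring f)

end Eigenring

end

end SkewPolynomial

/-! For each b, R acts F-linearly on K with scalars acting by multiplication and t as x ↦ bσ(x).
Then t^n acts as the norm N(b), so t^n - N(b) acts as zero. For b ≠ 0, a nonzero skew polynomial of
degree at most m acts as a polynomial function of degree at most q^m, so its kernel has at most q^m
elements. If f right divides t^n - N(b), this bound for both f and its cofactor forces |ker f| = q^m
(`card_ker_operator`). The eigenring of f is then all of End_F(ker f), a matrix algebra over F
(`nonempty_eigenring_algEquiv`).

Conversely, t^n is central in R, so in an A-polynomial's eigenring it becomes a scalar a, and f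
right divides t^n - a. The norm is surjective, so a = N(b), and b ≠ 0 because f is coprime to t.
Each nonzero kernel vector w splits off a right factor t - Ω_w(b); induction gives the product.

Given such a product with c_m = 1, its last factor t - b kills 1, so N(b) is a root of ĥ.
Irreducibility gives ĥ = x - N(b), and f right divides t^n - N(b). -/

namespace SkewPolynomial

section Coefficients

variable {K : Type*} [Field K]

/-- `f` is monic of degree `m`. -/
def MonicOfDegree (f : SkewPolynomial K) (m : ℕ) : Prop :=
  coeff f m = 1 ∧ ∀ i, m < i → coeff f i = 0

theorem exists_coeff_ne_zero {f : SkewPolynomial K} (hf : f ≠ 0) :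
    ∃ d, coeff f d ≠ 0 ∧ ∀ i, d < i → coeff f i = 0 := by
  have hne : f.support.Nonempty := by
    rwa [Finset.nonempty_iff_ne_empty, Ne, support_eq_empty]
  refine ⟨f.support.max' hne, mem_support_iff.1 (Finset.max'_mem _ hne), fun i hi => ?_⟩
  by_contra h
  exact absurd (Finset.le_max' _ i (mem_support_iff.2 h)) (not_le.2 hi)

theorem MonicOfDegree.ne_zero {f : SkewPolynomial K} {m : ℕ} (hf : MonicOfDegree f m) :
    f ≠ 0 := by
  rintro rfl
  exact zero_ne_one hf.1

theorem MonicOfDegree.degree_eq {f : SkewPolynomial K} {m : ℕ} (hf : MonicOfDegree f m) :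
    degree f = m := by
  have hm : m ∈ f.support := mem_support_iff.2 (by rw [hf.1]; exact one_ne_zero)
  refine le_antisymm (Finset.max_le fun i hi => WithBot.coe_le_coe.2 ?_) (Finset.le_max hm)
  by_contra! h
  exact mem_support_iff.1 hi (hf.2 i h)

theorem monicOfDegree_of_degree_eq {f : SkewPolynomial K} {m : ℕ} (hdeg : degree f = m)
    (h : coeff f m = 1) : MonicOfDegree f m := by
  refine ⟨h, fun i hi => ?_⟩
  by_contra hne
  have hle : (i : WithBot ℕ) ≤ degree f := Finset.le_max (mem_support_iff.2 hne)
  rw [hdeg] at hle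
  exact absurd (by exact_mod_cast hle) (not_le.2 hi)

theorem eq_sum_range_monomial {f : SkewPolynomial K} {D : ℕ} (hf : ∀ i, D ≤ i → coeff f i = 0) :
    f = ∑ i ∈ Finset.range D, monomial i (coeff f i) := by
  conv_lhs => rw [← sum_monomial f]
  refine sum_eq_of_subset _ (fun i => monomial_zero_right i) fun i hi => ?_
  rw [mem_support_iff] at hi
  rw [Finset.mem_range]
  by_contra! h
  exact hi (hf i h)

end Coefficients

/-! ### Degrees, right division and coprimality to t -/

section DegreeTheory

variable {K : Type*} [Field K] [MulSemiringAction (Multiplicative ℕ) K]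

theorem coeff_mul' (f g : SkewPolynomial K) (k : ℕ) :
    coeff (f * g) k =
      ∑ p ∈ Finset.HasAntidiagonal.antidiagonal k, coeff f p.1 * (φ : K →+* K)^[p.1] (coeff g p.2) := by
  simp only [φ_iterate_apply]
  exact SkewMonoidAlgebra.coeff_mul_antidiagonal_of_finset f g (Multiplicative.ofAdd k)
    (show Finset (Multiplicative ℕ × Multiplicative ℕ) from Finset.HasAntidiagonal.antidiagonal (A := ℕ) k)
    (fun {p} => Finset.HasAntidiagonal.mem_antidiagonal (A := ℕ) (n := k) (a := p))

theorem coeff_mul_add_of_coeff_eq_zero {f g : SkewPolynomial K} {d m : ℕ}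
    (hf : ∀ i, d < i → coeff f i = 0) (hg : ∀ i, m < i → coeff g i = 0) :
    coeff (f * g) (d + m) = coeff f d * (φ : K →+* K)^[d] (coeff g m) := by
  rw [coeff_mul', Finset.sum_eq_single (d, m)]
  · rintro ⟨i, j⟩ hij hne
    rw [Finset.HasAntidiagonal.mem_antidiagonal] at hij
    rcases lt_trichotomy i d with h | rfl | h
    · rw [hg j (by simp only at hij; omega), iterate_map_zero, mul_zero]
    · exact absurd (by simp only at hij; rw [Prod.mk.injEq]; omega) hne
    · rw [hf i h, zero_mul]
  · intro h
    exact h (Finset.HasAntidiagonal.mem_antidiagonal.2 rfl) |>.elim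

theorem coeff_mul_eq_zero {f g : SkewPolynomial K} {d m k : ℕ}
    (hf : ∀ i, d < i → coeff f i = 0) (hg : ∀ i, m < i → coeff g i = 0) (hk : d + m < k) :
    coeff (f * g) k = 0 := by
  rw [coeff_mul']
  refine Finset.sum_eq_zero ?_
  rintro ⟨i, j⟩ hij
  rw [Finset.HasAntidiagonal.mem_antidiagonal] at hij
  rcases lt_or_ge d i with h | h
  · rw [hf i h, zero_mul]
  · rw [hg j (by simp only at hij; omega), iterate_map_zero, mul_zero]

/-- The top coefficient of g survives in g * f because f has leading coefficient 1. -/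
theorem MonicOfDegree.coeff_left_eq_zero {f g : SkewPolynomial K} {m D : ℕ}
    (hf : MonicOfDegree f m) (h : ∀ i, D ≤ i → coeff (g * f) i = 0) (i : ℕ) (hi : D ≤ i + m) :
    coeff g i = 0 := by
  rcases eq_or_ne g 0 with rfl | hg
  · rfl
  obtain ⟨d, hd, hd'⟩ := exists_coeff_ne_zero hg
  have key := coeff_mul_add_of_coeff_eq_zero hd' hf.2
  rw [hf.1, iterate_map_one, mul_one] at key
  rcases lt_or_ge d i with h1 | h1
  · exact hd' i h1
  · exact absurd (key.symm.trans (h _ (by omega))) hd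

theorem MonicOfDegree.eq_zero_of_mul_eq_zero {f g : SkewPolynomial K} {m : ℕ}
    (hf : MonicOfDegree f m) (h : g * f = 0) : g = 0 := by
  ext i
  exact hf.coeff_left_eq_zero (D := 0) (fun j _ => by rw [h]; rfl) i (Nat.zero_le _)

theorem MonicOfDegree.mul_right_cancel {f g k : SkewPolynomial K} {m : ℕ}
    (hf : MonicOfDegree f m) (h : g * f = k * f) : g = k :=
  sub_eq_zero.1 (hf.eq_zero_of_mul_eq_zero (by rw [sub_mul, h, sub_self]))

theorem MonicOfDegree.of_mul_right {f g : SkewPolynomial K} {m D : ℕ}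
    (hf : MonicOfDegree f m) (h : MonicOfDegree (g * f) D) :
    m ≤ D ∧ MonicOfDegree g (D - m) := by
  have hz := hf.coeff_left_eq_zero (D := D + 1) h.2
  have hle : m ≤ D := by
    by_contra! hlt
    refine h.ne_zero ?_
    have : g = 0 := by
      ext i
      exact hz i (by omega)
    rw [this, zero_mul]
  have hz' : ∀ i, D - m < i → coeff g i = 0 := fun i hi => hz i (by omega)
  refine ⟨hle, ?_, hz'⟩
  have key := coeff_mul_add_of_coeff_eq_zero hz' hf.2
  rwa [Nat.sub_add_cancel hle, h.1, hf.1, iterate_map_one, mul_one, eq_comm] at key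

theorem monicOfDegree_X_pow_sub_C {n : ℕ} (hn : n ≠ 0) (a : K) :
    MonicOfDegree ((X : SkewPolynomial K) ^ n - C a) n := by
  rw [X_pow_eq_monomial]
  constructor
  · rw [coeff_sub, coeff_monomial, if_pos rfl, coeff_C_ne_zero hn, sub_zero]
  · intro i hi
    rw [coeff_sub, coeff_monomial, if_neg hi.ne, coeff_C_ne_zero (by omega), sub_zero]

theorem monicOfDegree_X_sub_C (a : K) : MonicOfDegree (X - C a) 1 := by
  simpa using monicOfDegree_X_pow_sub_C one_ne_zero a

theorem MonicOfDegree.eq_one {f : SkewPolynomial K} (hf : MonicOfDegree f 0) : f = 1 := by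
  ext i
  rw [coeff_one]
  split_ifs with h
  · rw [← h, hf.1]
  · exact hf.2 i (by omega)

/-- Right division with remainder by a monic skew polynomial. -/
theorem MonicOfDegree.exists_mul_add {f : SkewPolynomial K} {m : ℕ} (hf : MonicOfDegree f m)
    (g : SkewPolynomial K) : ∃ k r, g = k * f + r ∧ ∀ i, m ≤ i → coeff r i = 0 := by
  suffices H : ∀ D (g : SkewPolynomial K), (∀ i, D ≤ i → coeff g i = 0) →
      ∃ k r, g = k * f + r ∧ ∀ i, m ≤ i → coeff r i = 0 by
    rcases eq_or_ne g 0 with rfl | hg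
    · exact ⟨0, 0, by simp, fun _ _ => rfl⟩
    · obtain ⟨d, -, hd⟩ := exists_coeff_ne_zero hg
      exact H (d + 1) g hd
  intro D
  induction D with
  | zero => exact fun g hg => ⟨0, g, by simp, fun i _ => hg i (Nat.zero_le _)⟩
  | succ D ih =>
    intro g hg
    rcases lt_or_ge D m with h | h
    · exact ⟨0, g, by simp, fun i hi => hg i (by omega)⟩
    have hmon : ∀ i, D - m < i → coeff (monomial (D - m) (coeff g D)) i = 0 := fun i hi => by
      rw [coeff_monomial, if_neg hi.ne]
    obtain ⟨k, r, hk, hr⟩ := ih (g - monomial (D - m) (coeff g D) * f) (fun i hi => by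
      rw [coeff_sub]
      rcases hi.eq_or_lt with rfl | hi
      · have key := coeff_mul_add_of_coeff_eq_zero hmon hf.2
        rw [Nat.sub_add_cancel h, hf.1, iterate_map_one, mul_one, coeff_monomial,
          if_pos rfl] at key
        rw [key, sub_self]
      · rw [hg i hi, coeff_mul_eq_zero hmon hf.2 (by omega), sub_zero])
    exact ⟨k + monomial (D - m) (coeff g D), r, by
      rw [add_mul, add_right_comm, ← hk, sub_add_cancel], hr⟩

theorem coeff_zero_ne_zero_of_isGCRD {f : SkewPolynomial K} (h : IsGCRD f X 1) :
    coeff f 0 ≠ 0 := by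
  have coeff_mul_X_zero : ∀ k : SkewPolynomial K, coeff (k * X) 0 = 0 := fun k => by
    simp [coeff_mul']
  intro h0
  have hX : MonicOfDegree (X : SkewPolynomial K) 1 := by
    simpa using monicOfDegree_X_sub_C (0 : K)
  obtain ⟨k, r, hk, hr⟩ := hX.exists_mul_add f
  have hr0 : r = 0 := by
    ext i
    rcases i with _ | i
    · have := congrArg (fun p => coeff p 0) hk
      simpa [h0, coeff_mul_X_zero] using this.symm
    · exact hr _ (by omega)
  obtain ⟨l, hl⟩ := h.2.2 X ⟨k, by rw [hk, hr0, add_zero]⟩ ⟨1, (one_mul X).symm⟩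
  have := congrArg (fun p => coeff p 0) hl
  simp [coeff_mul_X_zero] at this

/-- Compare lowest terms: the constant term of f is nonzero and σ is injective, so a cofactor g has
no terms below degree n. But g has degree n - m < n. -/
theorem MonicOfDegree.not_rightDvd_X_pow {f : SkewPolynomial K} {m : ℕ} (hf : MonicOfDegree f m)
    (hm : 1 ≤ m) (h0 : coeff f 0 ≠ 0) {n : ℕ} (hn : n ≠ 0) : ¬ RightDvd f (X ^ n) := by
  rintro ⟨g, hg⟩
  have hX : MonicOfDegree ((X : SkewPolynomial K) ^ n) n := by
    simpa using monicOfDegree_X_pow_sub_C hn (0 : K)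
  obtain ⟨-, hgm⟩ := hf.of_mul_right (hg ▸ hX)
  have hlow : ∀ i, i < n → coeff g i = 0 := by
    intro i
    induction i using Nat.strong_induction_on with
    | _ i ih =>
      intro hi
      have key := congrArg (fun p => coeff p i) hg
      simp only [X_pow_eq_monomial, coeff_monomial, if_neg hi.ne'] at key
      rw [coeff_mul', Finset.sum_eq_single (i, 0)] at key
      · refine (mul_eq_zero.1 key.symm).resolve_right fun h => h0 ?_
        exact (φ : K →+* K).injective.iterate i (h.trans (iterate_map_zero _ _).symm)
      · rintro ⟨j, l⟩ hjl hne
        rw [Finset.HasAntidiagonal.mem_antidiagonal] at hjl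
        simp only at hjl
        have hl : l ≠ 0 := by
          rintro rfl
          exact hne (by rw [Prod.mk.injEq]; omega)
        rw [ih j (by omega) (by omega), zero_mul]
      · exact fun h => absurd (Finset.HasAntidiagonal.mem_antidiagonal.2 (by simp)) h
  refine hgm.ne_zero ?_
  ext i
  rcases lt_or_ge i n with h | h
  · exact hlow i h
  · exact hgm.2 i (by omega)

end DegreeTheory

end SkewPolynomial

/-! ### The representations of K[t;σ] on K -/

namespace SkewPolynomial

noncomputable section

variable {K : Type*} [Field K] [MulSemiringAction (Multiplicative ℕ) K]

/-- The `Fix(σ)`-linear operator `x ↦ b σ(x)` on `K`. -/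
def twistedFrobenius (b : K) : Module.End (FixedField K) K :=
  LinearMap.mulLeft (FixedField K) b *
    DistribSMul.toLinearMap (FixedField K) K (Multiplicative.ofAdd 1 : Multiplicative ℕ)

theorem twistedFrobenius_apply (b x : K) :
    twistedFrobenius b x = b * (φ : K →+* K) x := rfl

theorem twistedFrobenius_pow_mul (b c x : K) (i : ℕ) :
    (twistedFrobenius b ^ i) (c * x) = (φ : K →+* K)^[i] c * (twistedFrobenius b ^ i) x := by
  induction i with
  | zero => rfl
  | succ i ih =>
    rw [pow_succ', Module.End.mul_apply, Module.End.mul_apply, ih, twistedFrobenius_apply,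
      twistedFrobenius_apply, map_mul, Function.iterate_succ_apply']
    ring

/-- The representation of `K[t;σ]` on `K` in which scalars act by multiplication and `t` acts as
`x ↦ b σ(x)`. -/
def operator (b : K) : SkewPolynomial K →ₐ[FixedField K] Module.End (FixedField K) K :=
  SkewMonoidAlgebra.liftNCAlgHom (Algebra.lmul (FixedField K) K)
    (powersHom (Module.End (FixedField K) K) (twistedFrobenius b)) (by
      intro x y
      ext z
      have h := twistedFrobenius_pow_mul b x z (Multiplicative.toAdd y)
      rw [φ_iterate_apply] at h
      exact h.symm)

theorem operator_monomial_apply (b : K) (i : ℕ) (c x : K) :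
    operator b (monomial i c) x = c * (twistedFrobenius b ^ i) x := by
  have : operator b (monomial i c) =
      Algebra.lmul (FixedField K) K c * twistedFrobenius b ^ i :=
    SkewMonoidAlgebra.liftNC_single _ _ _ _
  rw [this]
  rfl

theorem operator_C_apply (b c x : K) : operator b (C c) x = c * x :=
  operator_monomial_apply b 0 c x

theorem operator_X (b : K) : operator b X = twistedFrobenius b := by
  ext x
  have := operator_monomial_apply b 1 1 x
  rwa [pow_one, one_mul] at this

theorem operator_X_sub_C_Omega_self (b : K) (w : Kˣ) :
    operator b (X - C (Omega w b)) w = 0 := by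
  rw [map_sub, LinearMap.sub_apply, operator_X, operator_C_apply, twistedFrobenius_apply, Omega]
  field_simp
  ring

theorem operator_apply_eq_sum {f : SkewPolynomial K} {D : ℕ} (hf : ∀ i, D ≤ i → coeff f i = 0)
    (b x : K) :
    operator b f x = ∑ i ∈ Finset.range D, coeff f i * (twistedFrobenius b ^ i) x := by
  conv_lhs => rw [eq_sum_range_monomial hf]
  rw [map_sum, LinearMap.sum_apply]
  exact Finset.sum_congr rfl fun i _ => operator_monomial_apply b i _ x

/-! ### Counting kernels over a finite field -/

section Finite

variable {q n : ℕ}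

theorem twistedFrobenius_pow_apply (hσ : ∀ a : K, (φ : K →+* K) a = a ^ q) (b x : K) (i : ℕ) :
    (twistedFrobenius b ^ i) x = b ^ (∑ j ∈ Finset.range i, q ^ j) * x ^ q ^ i := by
  induction i with
  | zero => simp
  | succ i ih =>
    rw [pow_succ', Module.End.mul_apply, ih, twistedFrobenius_apply, hσ, geom_sum_succ]
    ring

/-- By the formula for powers of x ↦ bσ(x), f acts as a linearised polynomial. Its exponents q ^ i
are distinct and b ≠ 0, so it is nonzero, and the kernel consists of its roots. -/
theorem card_ker_operator_le [Finite K] (hσ : ∀ a : K, (φ : K →+* K) a = a ^ q) (hq : 2 ≤ q)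
    {b : K} (hb : b ≠ 0) {f : SkewPolynomial K} (hf : f ≠ 0) {m : ℕ}
    (hm : ∀ i, m < i → coeff f i = 0) :
    Nat.card (LinearMap.ker (operator b f)) ≤ q ^ m := by
  classical
  set s : ℕ → ℕ := fun i => ∑ j ∈ Finset.range i, q ^ j
  set P : Polynomial K :=
    ∑ i ∈ Finset.range (m + 1), Polynomial.monomial (q ^ i) (coeff f i * b ^ s i) with hP
  have hdeg : P.natDegree ≤ q ^ m := by
    refine Polynomial.natDegree_sum_le_of_forall_le _ _ fun i hi => ?_
    rw [Finset.mem_range] at hi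
    exact (Polynomial.natDegree_monomial_le _).trans
      (Nat.pow_le_pow_right (by omega) (by omega))
  have hP0 : P ≠ 0 := by
    obtain ⟨d, hd, -⟩ := exists_coeff_ne_zero hf
    have hdm : d < m + 1 := by
      by_contra! h
      exact hd (hm d h)
    intro h
    have h1 : P.coeff (q ^ d) = coeff f d * b ^ s d := by
      rw [hP, Polynomial.finsetSum_coeff, Finset.sum_eq_single d]
      · rw [Polynomial.coeff_monomial, if_pos rfl]
      · intro i _ hi
        rw [Polynomial.coeff_monomial, if_neg fun h => hi (Nat.pow_right_injective hq h)]
      · exact fun h => absurd (Finset.mem_range.2 hdm) h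
    rw [h, Polynomial.coeff_zero] at h1
    exact mul_ne_zero hd (pow_ne_zero _ hb) h1.symm
  have hroot : ∀ x ∈ LinearMap.ker (operator b f), x ∈ P.roots.toFinset := by
    intro x hx
    rw [LinearMap.mem_ker, operator_apply_eq_sum (D := m + 1) hm] at hx
    rw [Multiset.mem_toFinset, Polynomial.mem_roots hP0, Polynomial.IsRoot.def, hP,
      Polynomial.eval_finsetSum, ← hx]
    refine Finset.sum_congr rfl fun i _ => ?_
    rw [Polynomial.eval_monomial, twistedFrobenius_pow_apply hσ, mul_assoc]
  calc Nat.card (LinearMap.ker (operator b f))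
      ≤ Nat.card P.roots.toFinset :=
        Nat.card_le_card_of_injective (fun x => ⟨x.1, hroot x.1 x.2⟩)
          fun x y h => Subtype.ext (Subtype.mk.inj h)
    _ = P.roots.toFinset.card := Nat.card_eq_card_toFinset _ |>.trans (by rw [Finset.toFinset_coe])
    _ ≤ q ^ m := (Multiset.toFinset_card_le _).trans ((Polynomial.card_roots' P).trans hdeg)

/-- The kernel of a monic right divisor of degree `m` of `X ^ n - a` has full size `q ^ m` in a
representation annihilated by `X ^ n - a`. -/
theorem card_ker_operator [Finite K] (hσ : ∀ a : K, (φ : K →+* K) a = a ^ q) (hq : 2 ≤ q)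
    (hK : Nat.card K = q ^ n) (hn : n ≠ 0) {b : K} (hb : b ≠ 0) {a : FixedField K}
    (ha : twistedFrobenius b ^ n = algebraMap _ _ a) {f : SkewPolynomial K} {m : ℕ}
    (hf : MonicOfDegree f m) (hfa : RightDvd f (X ^ n - algebraMap _ _ a)) :
    m ≤ n ∧ Nat.card (LinearMap.ker (operator b f)) = q ^ m := by
  obtain ⟨g, hg⟩ := hfa
  obtain ⟨hmn, hgm⟩ := hf.of_mul_right (hg ▸ monicOfDegree_X_pow_sub_C hn (a : K))
  refine ⟨hmn, le_antisymm (card_ker_operator_le hσ hq hb hf.ne_zero hf.2) ?_⟩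
  have hgf : operator b g * operator b f = 0 := by
    rw [← map_mul, ← hg, map_sub, map_pow, operator_X, ha, AlgHom.commutes, sub_self]
  -- The range of f lies in the kernel of its cofactor g, which has degree n - m.
  have hle : Nat.card (LinearMap.range (operator b f)) ≤ q ^ (n - m) := by
    refine le_trans ?_ (card_ker_operator_le hσ hq hb hgm.ne_zero hgm.2)
    refine Nat.card_le_card_of_injective (Submodule.inclusion ?_) (Submodule.inclusion_injective _)
    rintro _ ⟨x, rfl⟩
    exact LinearMap.congr_fun hgf x
  have hcard : Nat.card K = Nat.card (LinearMap.ker (operator b f)) *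
      Nat.card (LinearMap.range (operator b f)) := by
    rw [Submodule.card_eq_card_quotient_mul_card (LinearMap.ker (operator b f)),
      Nat.card_congr (operator b f).quotKerEquivRange.toEquiv, mul_comm]
  have h0 : 0 < q ^ (n - m) := by positivity
  refine Nat.le_of_mul_le_mul_right ?_ h0
  rw [← pow_add, Nat.add_sub_cancel' hmn, ← hK, hcard]
  exact Nat.mul_le_mul_left _ hle

theorem iterate_φ_card (hK : Nat.card K = q ^ n) [Finite K]
    (hσ : ∀ a : K, (φ : K →+* K) a = a ^ q) (x : K) : (φ : K →+* K)^[n] x = x := by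
  have h := twistedFrobenius_pow_mul 1 x 1 n
  rw [twistedFrobenius_pow_apply hσ, twistedFrobenius_pow_apply hσ] at h
  have : Fintype K := Fintype.ofFinite K
  simp only [one_pow, one_mul, mul_one] at h
  rw [← h, ← hK, Nat.card_eq_fintype_card, FiniteField.pow_card]

/-- The fixed field is the kernel of t - 1 in the representation with b = 1, and t - 1 right divides
t^n - 1. -/
theorem card_fixedField [Finite K] (hσ : ∀ a : K, (φ : K →+* K) a = a ^ q) (hq : 2 ≤ q)
    (hK : Nat.card K = q ^ n) (hn : n ≠ 0) : Nat.card (FixedField K) = q := by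
  have h1 : twistedFrobenius (1 : K) ^ n = algebraMap _ _ (1 : FixedField K) := by
    ext x
    have := twistedFrobenius_pow_mul 1 x 1 n
    rw [mul_one, iterate_φ_card hK hσ, twistedFrobenius_pow_apply hσ 1 1] at this
    simpa using this
  obtain ⟨-, h⟩ := card_ker_operator hσ hq hK hn one_ne_zero h1 (monicOfDegree_X_sub_C (1 : K))
    ⟨∑ i ∈ Finset.range n, X ^ i, by rw [C_1, geom_sum_mul, map_one]⟩
  rw [pow_one] at h
  rw [← h]
  refine Nat.card_congr (Equiv.subtypeEquivRight fun x => ?_)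
  rw [mem_fixedField_iff, LinearMap.mem_ker, map_sub, LinearMap.sub_apply, operator_X,
    operator_C_apply, twistedFrobenius_apply, one_mul, one_mul, sub_eq_zero]

/-- The exponent 1 + q + ⋯ + q^(n-1) of b is (|K| - 1)/(|F| - 1), which is the norm exponent. -/
theorem twistedFrobenius_pow_card [Finite K] (hσ : ∀ a : K, (φ : K →+* K) a = a ^ q)
    (hq : 2 ≤ q) (hK : Nat.card K = q ^ n) (hn : n ≠ 0) (b : K) :
    twistedFrobenius b ^ n = algebraMap _ _ (Algebra.norm (FixedField K) b) := by
  have : Fintype K := Fintype.ofFinite K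
  ext x
  rw [twistedFrobenius_pow_apply hσ, ← hK, Nat.card_eq_fintype_card, FiniteField.pow_card,
    Module.algebraMap_end_apply, Algebra.smul_def, FiniteField.algebraMap_norm_eq_pow,
    card_fixedField hσ hq hK hn, hK, Nat.geomSum_eq hq]

theorem X_pow_mem_center [Finite K] (hσ : ∀ a : K, (φ : K →+* K) a = a ^ q)
    (hK : Nat.card K = q ^ n) : (X : SkewPolynomial K) ^ n ∈ Subring.center (SkewPolynomial K) := by
  rw [Subring.mem_center_iff]
  intro p
  rw [X_pow_mul]
  simp only [iterate_φ_card hK hσ]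
  rw [sum_monomial]

end Finite

end

end SkewPolynomial

namespace SkewPolynomial

noncomputable section

variable {K : Type*} [Field K] [MulSemiringAction (Multiplicative ℕ) K]

/-! ### The eigenring as endomorphisms of the kernel -/

section Eigenring

variable [Finite K] {q n m : ℕ} {b : K} {f : SkewPolynomial K}

omit [Finite K] in
theorem operator_mem_ker_of_mem_leftIdealiser (b : K) (g : leftIdealiser f) {x : K}
    (hx : x ∈ LinearMap.ker (operator b f)) :
    operator b (g : SkewPolynomial K) x ∈ LinearMap.ker (operator b f) := by
  obtain ⟨k, hk⟩ := g.2
  rw [LinearMap.mem_ker] at hx ⊢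
  rw [← Module.End.mul_apply, ← map_mul, hk, map_mul, Module.End.mul_apply, hx, map_zero]

/-- The left idealiser of `f` acts on the kernel of the operator attached to `f`. -/
def leftIdealiserToEnd (b : K) (f : SkewPolynomial K) :
    leftIdealiser f →ₐ[FixedField K]
      Module.End (FixedField K) (LinearMap.ker (operator b f)) where
  toFun g := (operator b (g : SkewPolynomial K)).restrict
    fun _ hx => operator_mem_ker_of_mem_leftIdealiser b g hx
  map_one' := by
    ext x
    change operator b (1 : SkewPolynomial K) x = x
    rw [map_one, Module.End.one_apply]
  map_mul' g h := by
    ext x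
    change operator b ((g : SkewPolynomial K) * h) x = _
    rw [map_mul]
    rfl
  map_zero' := by
    ext x
    change operator b (0 : SkewPolynomial K) x = 0
    rw [map_zero, LinearMap.zero_apply]
  map_add' g h := by
    ext x
    change operator b ((g : SkewPolynomial K) + h) x = _
    rw [map_add]
    rfl
  commutes' r := by
    ext x
    change operator b (algebraMap _ (SkewPolynomial K) r) x = _
    rw [AlgHom.commutes]
    rfl

theorem eq_zero_of_ker_le (hσ : ∀ a : K, (φ : K →+* K) a = a ^ q) (hq : 2 ≤ q) (hb : b ≠ 0)
    (hcard : Nat.card (LinearMap.ker (operator b f)) = q ^ m) {r : SkewPolynomial K}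
    (hr : ∀ i, m ≤ i → coeff r i = 0)
    (hker : ∀ x ∈ LinearMap.ker (operator b f), operator b r x = 0) : r = 0 := by
  by_contra hne
  rcases m with _ | m
  · exact hne (ext fun i => hr i (Nat.zero_le _))
  have h1 := card_ker_operator_le hσ hq hb hne hr
  have h2 : Nat.card (LinearMap.ker (operator b f)) ≤ Nat.card (LinearMap.ker (operator b r)) :=
    Nat.card_le_card_of_injective (Submodule.inclusion hker) (Submodule.inclusion_injective _)
  have h3 : q ^ m < q ^ (m + 1) := Nat.pow_lt_pow_right hq (Nat.lt_succ_self m)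
  omega

/-- The remainder of g modulo f has degree below m, too small to vanish on q ^ m points unless it is
zero. -/
theorem rightDvd_iff_ker_le (hσ : ∀ a : K, (φ : K →+* K) a = a ^ q) (hq : 2 ≤ q) (hb : b ≠ 0)
    (hf : MonicOfDegree f m) (hcard : Nat.card (LinearMap.ker (operator b f)) = q ^ m)
    (g : SkewPolynomial K) :
    RightDvd f g ↔ ∀ x ∈ LinearMap.ker (operator b f), operator b g x = 0 := by
  constructor
  · rintro ⟨k, rfl⟩ x hx
    rw [map_mul, Module.End.mul_apply, LinearMap.mem_ker.1 hx, map_zero]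
  · intro h
    obtain ⟨k, r, rfl, hr⟩ := hf.exists_mul_add g
    refine ⟨k, ?_⟩
    rw [eq_zero_of_ker_le hσ hq hb hcard hr fun x hx => ?_, add_zero]
    have := h x hx
    rwa [map_add, LinearMap.add_apply, map_mul, Module.End.mul_apply, LinearMap.mem_ker.1 hx,
      map_zero, zero_add] at this

/-- The skew polynomial with given coefficients in degrees below `m`. -/
def ofCoeffs (m : ℕ) : (Fin m → K) →ₗ[K] SkewPolynomial K :=
  ∑ i : Fin m, (monomial (i : ℕ)).comp (LinearMap.proj i)

omit [MulSemiringAction (Multiplicative ℕ) K] [Finite K] in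
theorem coeff_ofCoeffs (v : Fin m → K) (j : ℕ) :
    coeff (ofCoeffs m v) j = ∑ i : Fin m, if (i : ℕ) = j then v i else 0 := by
  have hsum : ∀ (s : Finset (Fin m)) (F : Fin m → SkewPolynomial K),
      coeff (∑ i ∈ s, F i) j = ∑ i ∈ s, coeff (F i) j := by
    classical
    intro s F
    induction s using Finset.induction_on with
    | empty => rfl
    | insert a s ha ih => rw [Finset.sum_insert ha, Finset.sum_insert ha, coeff_add, ih]
  rw [ofCoeffs, LinearMap.sum_apply, hsum]
  exact Finset.sum_congr rfl fun i _ => coeff_monomial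

omit [MulSemiringAction (Multiplicative ℕ) K] [Finite K] in
theorem ofCoeffs_injective : Function.Injective (ofCoeffs m : (Fin m → K) → SkewPolynomial K) := by
  refine (injective_iff_map_eq_zero _).2 fun v hv => funext fun i => ?_
  have := coeff_ofCoeffs v i
  rw [hv, coeff_zero, Finset.sum_eq_single i (fun j _ hj => if_neg fun h => hj (Fin.ext h))
    (fun h => absurd (Finset.mem_univ i) h), if_pos rfl] at this
  exact this.symm

omit [MulSemiringAction (Multiplicative ℕ) K] [Finite K] in
theorem coeff_ofCoeffs_of_le (v : Fin m → K) (j : ℕ) (hj : m ≤ j) :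
    coeff (ofCoeffs m v) j = 0 := by
  rw [coeff_ofCoeffs]
  exact Finset.sum_eq_zero fun i _ => if_neg (by omega)

/-- Every linear map from the kernel of `operator b f` to `K` is given by a skew polynomial. -/
theorem exists_operator_eq (hσ : ∀ a : K, (φ : K →+* K) a = a ^ q) (hq : 2 ≤ q)
    (hb : b ≠ 0) (hcard : Nat.card (LinearMap.ker (operator b f)) = q ^ m)
    (hrank : Module.finrank (FixedField K) (LinearMap.ker (operator b f)) = m)
    (T : LinearMap.ker (operator b f) →ₗ[FixedField K] K) :
    ∃ g : SkewPolynomial K, ∀ x : LinearMap.ker (operator b f), operator b g x = T x := by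
  let S : (Fin m → K) → (LinearMap.ker (operator b f) →ₗ[FixedField K] K) := fun v =>
    (operator b (ofCoeffs m v)).comp (LinearMap.ker (operator b f)).subtype
  have hS : Function.Injective S := by
    intro v w h
    refine ofCoeffs_injective (sub_eq_zero.1 ?_)
    refine eq_zero_of_ker_le hσ hq hb hcard (fun i hi => ?_) fun x hx => ?_
    · rw [coeff_sub, coeff_ofCoeffs_of_le v i hi, coeff_ofCoeffs_of_le w i hi, sub_zero]
    · rw [map_sub, LinearMap.sub_apply, sub_eq_zero]
      exact LinearMap.congr_fun h ⟨x, hx⟩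
  let B := (Module.finBasisOfFinrankEq (FixedField K) (LinearMap.ker (operator b f)) hrank)
  let e : (Fin m → K) ≃ (LinearMap.ker (operator b f) →ₗ[FixedField K] K) :=
    (B.constr ℕ).toEquiv
  have : Finite (LinearMap.ker (operator b f) →ₗ[FixedField K] K) := Finite.of_equiv _ e
  -- Both sides have |K| ^ m elements, so injectivity suffices.
  have hbij : Function.Bijective S :=
    (Nat.bijective_iff_injective_and_card S).2 ⟨hS, Nat.card_congr e⟩
  obtain ⟨v, hv⟩ := hbij.2 T
  exact ⟨ofCoeffs m v, fun x => LinearMap.congr_fun hv x⟩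

/-- The eigenring of a monic right divisor of `X ^ n - a` is a full endomorphism algebra. -/
theorem nonempty_eigenring_algEquiv (hσ : ∀ a : K, (φ : K →+* K) a = a ^ q) (hq : 2 ≤ q)
    (hb : b ≠ 0) (hf : MonicOfDegree f m)
    (hcard : Nat.card (LinearMap.ker (operator b f)) = q ^ m)
    (hrank : Module.finrank (FixedField K) (LinearMap.ker (operator b f)) = m) :
    Nonempty (Eigenring f ≃ₐ[FixedField K]
      Module.End (FixedField K) (LinearMap.ker (operator b f))) := by
  have hmem : ∀ g : leftIdealiser f, g ∈ eigenIdeal f ↔ leftIdealiserToEnd b f g = 0 := by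
    intro g
    refine (rightDvd_iff_ker_le hσ hq hb hf hcard (g : SkewPolynomial K)).trans ?_
    constructor
    · intro h
      ext x
      exact h x x.2
    · intro h x hx
      exact congrArg Subtype.val (LinearMap.congr_fun h ⟨x, hx⟩)
  refine ⟨AlgEquiv.ofBijective
    (Ideal.Quotient.liftₐ (eigenIdeal f) (leftIdealiserToEnd b f) fun g hg => (hmem g).1 hg)
    ⟨(injective_iff_map_eq_zero _).2 fun y hy => ?_, fun T => ?_⟩⟩
  · obtain ⟨g, rfl⟩ := Ideal.Quotient.mk_surjective y
    exact Ideal.Quotient.eq_zero_iff_mem.2 ((hmem g).2 hy)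
  · obtain ⟨g, hg⟩ := exists_operator_eq hσ hq hb hcard hrank
      ((LinearMap.ker (operator b f)).subtype.comp T)
    -- As g maps the kernel of f into itself, f * g kills that kernel.
    have hgf : g ∈ leftIdealiser f := by
      refine (rightDvd_iff_ker_le hσ hq hb hf hcard _).2 fun x hx => ?_
      rw [map_mul, Module.End.mul_apply, hg ⟨x, hx⟩]
      exact (T ⟨x, hx⟩).2
    refine ⟨Ideal.Quotient.mk _ ⟨g, hgf⟩, ?_⟩
    ext x
    exact hg x

theorem isAPolynomial_of_rightDvd (hσ : ∀ a : K, (φ : K →+* K) a = a ^ q) (hq : 2 ≤ q)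
    (hK : Nat.card K = q ^ n) (hn : n ≠ 0) (hb : b ≠ 0) (hm : 1 ≤ m) (hf : MonicOfDegree f m)
    (hfb : RightDvd f (X ^ n - algebraMap _ _ (Algebra.norm (FixedField K) b))) :
    IsAPolynomial f := by
  obtain ⟨-, hcard⟩ := card_ker_operator hσ hq hK hn hb
    (twistedFrobenius_pow_card hσ hq hK hn b) hf hfb
  have hrank : Module.finrank (FixedField K) (LinearMap.ker (operator b f)) = m := by
    have h := Module.natCard_eq_pow_finrank (K := FixedField K)
      (V := LinearMap.ker (operator b f))
    rw [hcard, card_fixedField hσ hq hK hn] at h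
    exact (Nat.pow_right_injective hq h).symm
  obtain ⟨e⟩ := nonempty_eigenring_algEquiv hσ hq hb hf hcard hrank
  have : Nonempty (Fin m) := ⟨⟨0, hm⟩⟩
  let B := Module.finBasisOfFinrankEq (FixedField K) (LinearMap.ker (operator b f)) hrank
  exact ⟨Algebra.IsCentral.of_algEquiv _ _ _ e.symm,
    IsSimpleRing.of_ringEquiv
      ((algEquivMatrix B).symm.trans e.symm).toRingEquiv (IsSimpleRing.matrix _ _),
    Module.Finite.equiv e.symm.toLinearEquiv⟩

end Eigenring

/-! ### Linear factors and the minimal central left multiple -/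

section Factorization

variable [Finite K] {q n : ℕ}

omit [Finite K] in
-- Both f and X - Ω_w(b) kill w, hence so does the constant remainder; since w ≠ 0, it vanishes.
theorem MonicOfDegree.exists_linear_right_factor {f : SkewPolynomial K} {m : ℕ}
    (hf : MonicOfDegree f (m + 1)) {b : K} (w : Kˣ) (hw : operator b f w = 0) :
    ∃ k, f = k * (X - C (Omega w b)) ∧ MonicOfDegree k m := by
  obtain ⟨k, r, hk, hr⟩ := (monicOfDegree_X_sub_C (Omega w b)).exists_mul_add f
  have hrC : r = C (coeff r 0) := by
    ext i
    rcases i with _ | i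
    · rw [coeff_C_zero]
    · rw [hr _ (by omega), coeff_C_succ]
  have h0 : coeff r 0 * (w : K) = 0 := by
    rw [← operator_C_apply b, ← hrC, ← hw, hk, map_add, map_mul, LinearMap.add_apply,
      Module.End.mul_apply, operator_X_sub_C_Omega_self, map_zero, zero_add]
  have hr0 : r = 0 := by
    rw [hrC, (mul_eq_zero.1 h0).resolve_right w.ne_zero, C_0]
  rw [hr0, add_zero] at hk
  exact ⟨k, hk, ((monicOfDegree_X_sub_C _).of_mul_right (hk ▸ hf)).2⟩

theorem exists_eq_prod_of_rightDvd (hσ : ∀ a : K, (φ : K →+* K) a = a ^ q) (hq : 2 ≤ q)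
    (hK : Nat.card K = q ^ n) (hn : n ≠ 0) {b : K} (hb : b ≠ 0) (m : ℕ) :
    ∀ f : SkewPolynomial K, MonicOfDegree f m →
      RightDvd f (X ^ n - algebraMap _ _ (Algebra.norm (FixedField K) b)) →
      ∃ c : ℕ → Kˣ, f = ((List.range m).map fun i : ℕ =>
          (X : SkewPolynomial K) - C (Omega (c (i + 1)) b)).prod := by
  induction m with
  | zero => exact fun f hf _ => ⟨1, by simpa using hf.eq_one⟩
  | succ m ih =>
    intro f hf hfb
    obtain ⟨-, hcard⟩ := card_ker_operator hσ hq hK hn hb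
      (twistedFrobenius_pow_card hσ hq hK hn b) hf hfb
    have hne : LinearMap.ker (operator b f) ≠ ⊥ := by
      intro h
      rw [h, Nat.card_unique] at hcard
      exact absurd hcard.symm (Nat.one_lt_pow (by omega) hq).ne'
    obtain ⟨w, hw, hw0⟩ := Submodule.exists_mem_ne_zero_of_ne_bot hne
    obtain ⟨k, hk, hkm⟩ := hf.exists_linear_right_factor (Units.mk0 w hw0) hw
    set l : SkewPolynomial K := X - C (Omega (Units.mk0 w hw0) b)
    have hcentral : ∀ p : SkewPolynomial K,
        p * (X ^ n - algebraMap _ _ (Algebra.norm (FixedField K) b)) =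
          (X ^ n - algebraMap _ _ (Algebra.norm (FixedField K) b)) * p := fun p => by
      rw [mul_sub, sub_mul, Subring.mem_center_iff.1 (X_pow_mem_center hσ hK) p,
        Algebra.commutes]
    obtain ⟨g, hg⟩ := hfb
    -- With Z = X ^ n - N(b) central and Z = g * k * l, one has Z * l = l * Z = (l * g * k) * l.
    -- Cancelling l shows that k right divides Z.
    obtain ⟨c, hc⟩ := ih k hkm ⟨l * g, (monicOfDegree_X_sub_C _).mul_right_cancel
      (by rw [← hcentral, mul_assoc, mul_assoc, ← hk, hg])⟩
    refine ⟨Function.update c (m + 1) (Units.mk0 w hw0), ?_⟩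
    rw [List.range_succ, List.map_append, List.prod_append, List.map_singleton,
      List.prod_singleton, Function.update_self, hk, hc]
    congr 2
    refine List.map_congr_left fun i hi => ?_
    rw [List.mem_range] at hi
    rw [Function.update_of_ne (by omega)]

omit [Finite K] in
-- Ω is a group action, so replacing b by Ω_w(b) divides every c_i by w; this normalises c_m to 1.
theorem Omega_div_Omega (v w : Kˣ) (b : K) : Omega (v / w) (Omega w b) = Omega v b := by
  have hw : (φ : K →+* K) w ≠ 0 := (map_ne_zero _).2 w.ne_zero
  simp only [Omega, div_eq_mul_inv, Units.val_mul, Units.val_inv_eq_inv_val, map_mul, map_inv₀]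
  field_simp

omit [Finite K] in
theorem Omega_one (b : K) : Omega 1 b = b := by
  simp [Omega]

theorem IsAPolynomial.exists_rightDvd (hσ : ∀ a : K, (φ : K →+* K) a = a ^ q)
    (hK : Nat.card K = q ^ n) {f : SkewPolynomial K} (h : IsAPolynomial f) :
    ∃ a : FixedField K, RightDvd f (X ^ n - algebraMap _ _ a) := by
  have hX := Subring.mem_center_iff.1 (X_pow_mem_center hσ hK)
  let z : leftIdealiser f := ⟨X ^ n, X ^ n, hX f⟩
  have hz : Ideal.Quotient.mk (eigenIdeal f) z ∈
      Subalgebra.center (FixedField K) (Eigenring f) := by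
    rw [Subalgebra.mem_center_iff]
    intro y
    obtain ⟨g, rfl⟩ := Ideal.Quotient.mk_surjective y
    rw [← map_mul, ← map_mul]
    exact congrArg _ (Subtype.ext (hX g))
  obtain ⟨a, ha⟩ := Algebra.mem_bot.1 (h.1.out hz)
  refine ⟨a, ?_⟩
  have ha' : Ideal.Quotient.mk (eigenIdeal f) z =
      Ideal.Quotient.mk (eigenIdeal f) (algebraMap _ _ a) := ha.symm
  exact Ideal.Quotient.eq.1 ha'

theorem rightDvd_of_rightDvd_aeval (hσ : ∀ a : K, (φ : K →+* K) a = a ^ q) (hq : 2 ≤ q)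
    (hK : Nat.card K = q ^ n) (hn : n ≠ 0) {f k : SkewPolynomial K} {b : K}
    (hf : f = k * (X - C b)) {p : Polynomial (FixedField K)} (hp : p.Monic)
    (hirr : Irreducible p) (h : RightDvd f (Polynomial.aeval ((X : SkewPolynomial K) ^ n) p)) :
    RightDvd f (X ^ n - algebraMap _ _ (Algebra.norm (FixedField K) b)) := by
  obtain ⟨g, hg⟩ := h
  have hroot : p.IsRoot (Algebra.norm (FixedField K) b) := by
    have h1 : operator b (Polynomial.aeval ((X : SkewPolynomial K) ^ n) p) 1 = 0 := by
      have h2 := operator_X_sub_C_Omega_self b 1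
      rw [Omega_one, Units.val_one] at h2
      rw [hg, hf, map_mul, map_mul, Module.End.mul_apply, Module.End.mul_apply, h2, map_zero,
        map_zero]
    rw [← Polynomial.aeval_algHom_apply, map_pow, operator_X,
      twistedFrobenius_pow_card hσ hq hK hn, Polynomial.aeval_algebraMap_apply,
      Module.algebraMap_end_apply, Algebra.smul_def, mul_one, map_eq_zero_iff _
        (algebraMap (FixedField K) K).injective] at h1
    simpa using h1
  have hlin : p = Polynomial.X - Polynomial.C (Algebra.norm (FixedField K) b) :=
    (Polynomial.eq_of_monic_of_associated (Polynomial.monic_X_sub_C _) hp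
      ((Polynomial.irreducible_X_sub_C _).associated_of_dvd hirr
        (Polynomial.dvd_iff_isRoot.2 hroot))).symm
  rw [hlin, map_sub, Polynomial.aeval_X, Polynomial.aeval_C] at hg
  exact ⟨g, hg⟩

end Factorization

end

end SkewPolynomial

/-! ### The characterisation of A-polynomials -/

theorem corollary7 {K : Type*} [Field K] [Finite K] (q n : ℕ) (hq : IsPrimePow q)
    (hK : Nat.card K = q ^ n)
    [MulSemiringAction (Multiplicative ℕ) K]
    (hσ : ∀ a : K, (SkewPolynomial.φ : K →+* K) a = a ^ q)
    (f : SkewPolynomial K) (m : ℕ) (hm : 1 ≤ m)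
    (hdeg : SkewPolynomial.degree f = (m : WithBot ℕ))
    (hmonic : SkewPolynomial.coeff f m = 1)
    (hft : SkewPolynomial.IsGCRD f SkewPolynomial.X 1)
    (hhat : Polynomial (SkewPolynomial.FixedField K))
    (hhat_monic : hhat.Monic) (hhat_irr : Irreducible hhat)
    (hh : SkewPolynomial.IsMinimalCentralLeftMultiple f
      (Polynomial.aeval ((SkewPolynomial.X : SkewPolynomial K) ^ n) hhat)) :
    (SkewPolynomial.IsAPolynomial f ↔
      m ≤ n ∧ ∃ (c : ℕ → Kˣ) (b : Kˣ), c m = 1 ∧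
        f = ((List.range m).map fun i : ℕ =>
          (SkewPolynomial.X : SkewPolynomial K) -
            SkewPolynomial.C (SkewPolynomial.Omega (c (i + 1)) (b : K))).prod) ∧
    (SkewPolynomial.IsAPolynomial f → m ≠ 1 → SkewPolynomial.IsReducible f) := by
  open SkewPolynomial in
  have hq2 : 2 ≤ q := hq.two_le
  have hn : n ≠ 0 := by
    rintro rfl
    exact absurd hK (by rw [pow_zero]; exact Finite.one_lt_card.ne')
  have hf : MonicOfDegree f m := monicOfDegree_of_degree_eq hdeg hmonic
  obtain ⟨m, rfl⟩ : ∃ l, m = l + 1 := ⟨m - 1, by omega⟩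
  have split_last : ∀ (c : ℕ → Kˣ) (b : K), ((List.range (m + 1)).map fun i : ℕ =>
      (X : SkewPolynomial K) - C (Omega (c (i + 1)) b)).prod =
      ((List.range m).map fun i : ℕ => (X : SkewPolynomial K) - C (Omega (c (i + 1)) b)).prod *
        (X - C (Omega (c (m + 1)) b)) := fun c b => by
    rw [List.range_succ, List.map_append, List.prod_append, List.map_singleton,
      List.prod_singleton]
  have forward : IsAPolynomial f → m + 1 ≤ n ∧ ∃ (c : ℕ → Kˣ) (b : Kˣ), c (m + 1) = 1 ∧
      f = ((List.range (m + 1)).map fun i : ℕ =>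
        (X : SkewPolynomial K) - C (Omega (c (i + 1)) (b : K))).prod := by
    intro hA
    obtain ⟨a, ha⟩ := hA.exists_rightDvd hσ hK
    obtain ⟨b, rfl⟩ := FiniteField.norm_surjective (FixedField K) K a
    -- If b = 0, then f would right divide X ^ n, contradicting its coprimality to t.
    have hb : b ≠ 0 := by
      rintro rfl
      refine hf.not_rightDvd_X_pow hm (coeff_zero_ne_zero_of_isGCRD hft) hn ?_
      rwa [Algebra.norm_zero, map_zero, sub_zero] at ha
    obtain ⟨hmn, -⟩ := card_ker_operator hσ hq2 hK hn hb
      (twistedFrobenius_pow_card hσ hq2 hK hn b) hf ha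
    obtain ⟨c, hc⟩ := exists_eq_prod_of_rightDvd hσ hq2 hK hn hb (m + 1) f hf ha
    have hΩ : Omega (c (m + 1)) b ≠ 0 :=
      mul_ne_zero (mul_ne_zero ((map_ne_zero _).2 (c (m + 1)).ne_zero) hb)
        (inv_ne_zero (c (m + 1)).ne_zero)
    refine ⟨hmn, fun i => c i / c (m + 1), Units.mk0 _ hΩ, div_self' _, ?_⟩
    simp only [Units.val_mk0, Omega_div_Omega]
    exact hc
  refine ⟨⟨forward, ?_⟩, fun hA hm1 => ?_⟩
  · rintro ⟨-, c, b, hc, hprod⟩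
    rw [split_last, hc, Omega_one] at hprod
    exact isAPolynomial_of_rightDvd hσ hq2 hK hn b.ne_zero hm hf
      (rightDvd_of_rightDvd_aeval hσ hq2 hK hn hprod hhat_monic hhat_irr hh.2.2.1)
  · obtain ⟨-, c, b, -, hprod⟩ := forward hA
    rw [split_last] at hprod
    have hl := monicOfDegree_X_sub_C (Omega (c (m + 1)) (b : K))
    obtain ⟨-, hk⟩ := hl.of_mul_right (hprod ▸ hf)
    refine ⟨_, _, hprod, ?_, ?_⟩
    · rw [hk.degree_eq, hf.degree_eq]
      exact_mod_cast Nat.lt_succ_self m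
    · rw [hl.degree_eq, hf.degree_eq]
      exact_mod_cast (by omega : 1 < m + 1)
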